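/- Let $r\ge 0$ be an integer and let $Z\subset\mathbb{P}^r_{\mathbb{C}}$ be a reduced closed subscheme of complex projective space with irreducible components $T_1,\dots,T_s$. Assume that each $T_i$ (with its reduced scheme structure) is a rational variety over $\mathbb{C}$ of dimension at most $r-2$. Then there are a birational map $\omega\colon\mathbb{P}^r\dashrightarrow\mathbb{P}^r$ over $\mathbb{C}$ and $s$ pairwise distinct closed points $q_1,\dots,q_s\in\mathbb{P}^r$ such that $\omega$ contracts $T_i$ to $q_i$ for every $i$; that is, $\omega$ is defined on a dense open subset of $T_i$ and maps this subset to the single point $q_i$. -/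

import Mathlib

open CategoryTheory AlgebraicGeometry TopologicalSpace

attribute [local instance] MvPolynomial.gradedAlgebra

noncomputable section

/-- Complex projective space of dimension `r`, as the scheme `Proj ℂ[x₀, …, x_r]`. -/
def ComplexProjectiveSpace (r : ℕ) : Scheme.{0} :=
  Proj (MvPolynomial.homogeneousSubmodule (Fin (r + 1)) ℂ)

/-- The structure morphism of complex projective space. -/
def ComplexProjectiveSpace.structureMap (r : ℕ) :
    ComplexProjectiveSpace r ⟶ Spec (CommRingCat.of ℂ) :=
  Proj.toSpecZero (MvPolynomial.homogeneousSubmodule (Fin (r + 1)) ℂ) ≫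
    Spec.map (CommRingCat.ofHom
      (algebraMap ℂ (MvPolynomial.homogeneousSubmodule (Fin (r + 1)) ℂ 0)))

/-- The closed subset `T` of `Z`, as a closed subscheme with its reduced induced structure. -/
def reducedSubscheme {Z : Scheme.{0}} (T : Closeds Z) : Scheme.{0} :=
  (Scheme.IdealSheafData.vanishingIdeal T).subscheme

/-- The inclusion of the reduced closed subscheme supported on `T`. -/
def reducedSubschemeι {Z : Scheme.{0}} (T : Closeds Z) : reducedSubscheme T ⟶ Z :=
  (Scheme.IdealSheafData.vanishingIdeal T).subschemeι

/-- An irreducible component, as a closed subset. -/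
def componentClosed {Z : Scheme.{0}} (T : irreducibleComponents Z) : Closeds Z :=
  ⟨T.1, isClosed_of_mem_irreducibleComponents T.1 T.2⟩

/-- A rational map between schemes over `S` is birational over `S` if it is represented by an
`S`-isomorphism between dense open subschemes. -/
def IsBirationalMapOver {S X Y : Scheme.{0}} (sX : X ⟶ S) (sY : Y ⟶ S) (ω : X ⤏ Y) : Prop :=
  ∃ f : X.PartialIso Y, f.IsOver sX sY ∧ f.toRationalMap = ω

/-- The rational map `ω` contracts the irreducible closed subset `T` to the point `q`: the map `ω`
is defined on a nonempty (hence dense) relatively open subset of `T`, and maps it to the closed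
point `q`. -/
def ContractsTo {X Y : Scheme.{0}} (ω : X ⤏ Y) (T : Set X) (q : Y) : Prop :=
  IsClosed ({q} : Set Y) ∧
    ∃ g : X.PartialMap Y, g.toRationalMap = ω ∧
      g.hom '' {x : g.domain.toScheme | g.domain.ι x ∈ T} = {q}

end

/-! A hyperplane avoiding the generic points of the components reduces the problem to affine space
of dimension `m + 1 = r` and incomparable primes `P i`, whose varieties V_i have dimension at most
`m - 1`.

For a suitable direction `v`, the projection π along `v` to affine `m`-space sends the V_i to sets
with incomparable closures (`exists_linearProjection_separating`). Indeed, take a point t of V_j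
outside V_i. The cone over V_i with vertex t has dimension at most `m`, so it lies in a hypersurface
H(x - t) = 0 with H homogeneous. If H(v) ≠ 0, then π is finite on V_i and the line through t in the
direction `v` misses V_i, so π(t) is not in the closed set π(V_i).

Hence some rational function N/D on the target of π takes distinct constant values c_i on the
π(V_i), and for dimension reasons some nonzero F vanishes on all of them. Put y₀ = F x₀ + N/D and y
= π(x) ∏ (y₀ - c_i). On V_i this is the point (c_i, 0). The map is birational because it is
triangular: y₀ and y determine π(x), and then x₀ = (y₀ - N/D)/F. This is
`exists_contracting_algHom`; `exists_birational_contracting_of_chart` turns it into a rational map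
of schemes. -/

/-! ### Krull dimension and transcendence degree -/

/-- An integral extension does not lower the Krull dimension. -/
theorem ringKrullDim_le_of_isIntegral_of_injective {R S : Type*} [CommRing R] [CommRing S]
    [Algebra R S] [Algebra.IsIntegral R S] (h : Function.Injective (algebraMap R S)) :
    ringKrullDim R ≤ ringKrullDim S := by
  refine iSup_le fun l => ?_
  obtain ⟨Q, -, hQ, hQl⟩ := Ideal.exists_ideal_over_prime_of_isIntegral l.head.asIdeal (⊥ : Ideal S)
    (by
      rw [← RingHom.ker_eq_comap_bot, (RingHom.injective_iff_ker_eq_bot _).mp h]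
      exact bot_le)
  have : Q.LiesOver l.head.asIdeal := ⟨hQl.symm⟩
  obtain ⟨L, hL, -⟩ := Ideal.exists_ltSeries_of_hasGoingUp l Q
  rw [← hL]
  exact Order.LTSeries.length_le_krullDim L

/-- The transcendence degree of an affine domain is at most its Krull dimension. -/
theorem trdeg_le_of_ringKrullDim_le {k S : Type*} [Field k] [CommRing S] [IsDomain S] [Algebra k S]
    [Algebra.FiniteType k S] {n : ℕ} (h : ringKrullDim S ≤ n) : Algebra.trdeg k S ≤ n := by
  -- Noether normalization: the number `s` of variables equals the transcendence degree and is at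
  -- most the Krull dimension.
  obtain ⟨s, g, hg, hgi⟩ := exists_integral_inj_algHom_of_fg k S
  have hs : IsTranscendenceBasis k (fun i => g (MvPolynomial.X i)) := by
    have hind : AlgebraicIndependent k (fun i => g (MvPolynomial.X i)) := by
      have e : g = MvPolynomial.aeval (fun i => g (MvPolynomial.X i)) := by
        ext i; simp
      rw [AlgebraicIndependent, ← e]
      exact hg
    rw [hind.isTranscendenceBasis_iff_isAlgebraic]
    have hr : Algebra.adjoin k (Set.range fun i => g (MvPolynomial.X i)) = g.range := by
      rw [← Algebra.map_top, ← MvPolynomial.adjoin_range_X, AlgHom.map_adjoin, ← Set.range_comp]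
      rfl
    rw [hr]
    refine ⟨fun x => ?_⟩
    obtain ⟨p, hp, hpx⟩ := hgi x
    refine ⟨p.map (g.rangeRestrict : _ →+* g.range), (hp.map _).ne_zero, ?_⟩
    rw [Polynomial.aeval_def, Polynomial.eval₂_map]
    exact hpx
  rw [← Cardinal.lift_le_nat_iff, ← hs.lift_cardinalMk_eq_trdeg]
  simp only [Cardinal.mk_fin, Cardinal.lift_natCast, Nat.cast_le]
  algebraize [g.toRingHom]
  have h1 := (ringKrullDim_le_of_isIntegral_of_injective
    (R := MvPolynomial (Fin s) k) (S := S) hg).trans h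
  simpa using h1

theorem trdeg_polynomial_eq_add_one (k : Type*) {S : Type*} [Field k] [CommRing S] [IsDomain S]
    [Algebra k S] : Algebra.trdeg k (Polynomial S) = Algebra.trdeg k S + 1 := by
  rw [← _root_.trdeg_add_eq k S (A := Polynomial S), Polynomial.trdeg_of_isDomain]

/-- A polynomial ring in more variables than the transcendence degree does not embed. -/
theorem exists_ne_zero_map_eq_zero_of_trdeg_lt {k : Type*} {S : Type*} [Field k] [CommRing S]
    [Algebra k S] {n : ℕ} (h : Algebra.trdeg k S < n) (φ : MvPolynomial (Fin n) k →ₐ[k] S) :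
    ∃ p, p ≠ 0 ∧ φ p = 0 := by
  by_contra! hc
  have hinj : Function.Injective φ :=
    (injective_iff_map_eq_zero φ).mpr fun a ha => by_contra fun hne => hc a hne ha
  have := _root_.lift_trdeg_le_of_injective φ hinj
  rw [MvPolynomial.trdeg_of_isDomain] at this
  simp only [Cardinal.mk_fin, Cardinal.lift_natCast, Cardinal.nat_le_lift_iff] at this
  exact absurd h (not_lt.mpr this)

/-! ### Homogeneous relations and integral dependence -/

theorem MvPolynomial.IsHomogeneous.aeval_mul {σ k S : Type*} [Fintype σ] [CommSemiring k]
    [CommSemiring S] [Algebra k S] {F : MvPolynomial σ k} {d : ℕ} (hF : F.IsHomogeneous d)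
    (c : S) (z : σ → S) :
    MvPolynomial.aeval (fun i => c * z i) F = c ^ d * MvPolynomial.aeval z F := by
  rw [MvPolynomial.aeval_def, MvPolynomial.aeval_def, MvPolynomial.eval₂_eq',
    MvPolynomial.eval₂_eq', Finset.mul_sum]
  refine Finset.sum_congr rfl fun e he => ?_
  have hd : ∑ i, e i = d := by
    rw [← hF (MvPolynomial.mem_support_iff.mp he), Finsupp.weight_apply, Finsupp.sum_fintype]
    · simp
    · simp
  simp only [mul_pow, Finset.prod_mul_distrib, Finset.prod_pow_eq_pow_sum, hd]
  ring

/-- Too many elements of an algebra of small transcendence degree satisfy a homogeneous relation. -/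
theorem exists_isHomogeneous_aeval_eq_zero {k S : Type*} [Field k] [CommRing S] [IsDomain S]
    [Algebra k S] {n : ℕ} (h : Algebra.trdeg k S + 1 < n) (z : Fin n → S) :
    ∃ (d : ℕ) (H : MvPolynomial (Fin n) k), H ≠ 0 ∧ H.IsHomogeneous d ∧
      MvPolynomial.aeval z H = 0 := by
  -- The extra variable of `Polynomial S` records degrees: the coefficient of `X ^ d` in the
  -- relation is the degree `d` component of `G` evaluated at `z`.
  obtain ⟨G, hG, hG0⟩ := exists_ne_zero_map_eq_zero_of_trdeg_lt (k := k) (S := Polynomial S)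
    (by rwa [trdeg_polynomial_eq_add_one]) (MvPolynomial.aeval fun i => Polynomial.X * Polynomial.C (z i))
  have hsum : MvPolynomial.aeval (fun i => Polynomial.X * Polynomial.C (z i)) G =
      ∑ d ∈ Finset.range (G.totalDegree + 1),
        Polynomial.X ^ d * Polynomial.C (MvPolynomial.aeval z
          (MvPolynomial.homogeneousComponent d G)) := by
    conv_lhs => rw [← MvPolynomial.sum_homogeneousComponent G, map_sum]
    refine Finset.sum_congr rfl fun d _ => ?_
    rw [(MvPolynomial.homogeneousComponent_isHomogeneous d G).aeval_mul Polynomial.X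
      (fun i => Polynomial.C (z i))]
    congr 1
    exact (MvPolynomial.aeval_algebraMap_apply (Polynomial S) z _)
  obtain ⟨d, hd⟩ : ∃ d, MvPolynomial.homogeneousComponent d G ≠ 0 := by
    by_contra! hc
    refine hG ?_
    rw [← MvPolynomial.sum_homogeneousComponent G]
    exact Finset.sum_eq_zero fun d _ => hc d
  have hdG : d < G.totalDegree + 1 := by
    by_contra hlt
    exact hd (MvPolynomial.homogeneousComponent_eq_zero d G (by omega))
  refine ⟨d, _, hd, MvPolynomial.homogeneousComponent_isHomogeneous d G, ?_⟩
  rw [hG0] at hsum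
  have := congrArg (fun p => Polynomial.coeff p d) hsum
  simp only [Polynomial.coeff_zero, Polynomial.finsetSum_coeff, Polynomial.coeff_X_pow_mul',
    Polynomial.coeff_C] at this
  rw [Finset.sum_eq_single d] at this
  · simpa using this.symm
  · intro b _ hb
    split_ifs
    · omega
    · rfl
    · rfl
  · intro h
    exact absurd (Finset.mem_range.mpr hdG) h

/-- The degree is only bounded, since some `a i` may vanish; the coefficient at the bound is still
multiplicative. -/
theorem Polynomial.natDegree_prod_linear_pow_le {σ R : Type*} [CommRing R] (s : Finset σ)
    (w a : σ → R) (e : σ → ℕ) :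
    (∏ i ∈ s, (Polynomial.C (w i) + Polynomial.C (a i) * Polynomial.X) ^ e i).natDegree ≤
        ∑ i ∈ s, e i ∧
      (∏ i ∈ s, (Polynomial.C (w i) + Polynomial.C (a i) * Polynomial.X) ^ e i).coeff
        (∑ i ∈ s, e i) = ∏ i ∈ s, a i ^ e i := by
  classical
  have hlin (i : σ) : (Polynomial.C (w i) + Polynomial.C (a i) * Polynomial.X).natDegree ≤ 1 := by
    rw [add_comm]
    exact Polynomial.natDegree_linear_le
  have hpow (i : σ) :
      ((Polynomial.C (w i) + Polynomial.C (a i) * Polynomial.X) ^ e i).natDegree ≤ e i := by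
    simpa using Polynomial.natDegree_pow_le_of_le (e i) (hlin i)
  induction s using Finset.induction_on with
  | empty => simp
  | insert i s hi ih =>
    rw [Finset.prod_insert hi, Finset.sum_insert hi, Finset.prod_insert hi]
    refine ⟨Polynomial.natDegree_mul_le_of_le (hpow i) ih.1, ?_⟩
    rw [Polynomial.coeff_mul_add_eq_of_natDegree_le (hpow i) ih.1, ih.2]
    congr 1
    have := Polynomial.coeff_pow_of_natDegree_le (hlin i) (m := e i)
    rw [mul_one] at this
    rw [this]
    simp [Polynomial.coeff_C]

/-- A homogeneous equation whose top coefficient in the direction `v` does not vanish is an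
equation of integral dependence. -/
theorem isIntegral_of_isHomogeneous_aeval_eq_zero {σ k B S : Type*} [Fintype σ] [Field k]
    [CommRing B] [CommRing S] [Algebra k B] [Algebra B S] [Algebra k S] [IsScalarTower k B S]
    {H : MvPolynomial σ k} {d : ℕ} (hH : H.IsHomogeneous d) {v : σ → k}
    (hv : MvPolynomial.eval v H ≠ 0) (w : σ → B) (x : S)
    (hx : MvPolynomial.aeval (fun i => algebraMap B S (w i) + algebraMap k S (v i) * x) H = 0) :
    IsIntegral B x := by
  let l : σ → Polynomial B := fun i =>
    Polynomial.C (w i) + Polynomial.C (algebraMap k B (v i)) * Polynomial.X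
  have hsum (e : σ →₀ ℕ) (he : e ∈ H.support) : ∑ i, e i = d := by
    rw [← hH (MvPolynomial.mem_support_iff.mp he), Finsupp.weight_apply, Finsupp.sum_fintype]
    · simp
    · simp
  have hq : MvPolynomial.aeval l H =
      ∑ e ∈ H.support, Polynomial.C (algebraMap k B (H.coeff e)) * ∏ i, l i ^ e i := by
    rw [MvPolynomial.aeval_def, MvPolynomial.eval₂_eq']
    rfl
  have hdeg : (MvPolynomial.aeval l H).natDegree ≤ d := by
    rw [hq]
    refine Polynomial.natDegree_sum_le_of_forall_le _ _ fun e he => ?_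
    refine (Polynomial.natDegree_C_mul_le _ _).trans ?_
    rw [← hsum e he]
    exact (Polynomial.natDegree_prod_linear_pow_le Finset.univ w _ e).1
  have hcoeff : (MvPolynomial.aeval l H).coeff d = algebraMap k B (MvPolynomial.eval v H) := by
    rw [hq, Polynomial.finsetSum_coeff, MvPolynomial.eval_eq', map_sum]
    refine Finset.sum_congr rfl fun e he => ?_
    rw [Polynomial.coeff_C_mul, ← hsum e he,
      (Polynomial.natDegree_prod_linear_pow_le Finset.univ w _ e).2]
    simp
  -- The coefficient in degree `d` is the nonzero scalar H(v), so dividing by it gives a monic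
  -- equation for `x`.
  refine ⟨Polynomial.C (algebraMap k B (MvPolynomial.eval v H)⁻¹) * MvPolynomial.aeval l H, ?_, ?_⟩
  · refine Polynomial.monic_of_natDegree_le_of_coeff_eq_one d
      ((Polynomial.natDegree_C_mul_le _ _).trans hdeg) ?_
    rw [Polynomial.coeff_C_mul, hcoeff, ← map_mul, inv_mul_cancel₀ hv, map_one]
  · rw [← Polynomial.aeval_def, map_mul]
    have : Polynomial.aeval x (MvPolynomial.aeval l H) = 0 := by
      rw [← hx]
      have hc := MvPolynomial.comp_aeval_apply l ((Polynomial.aeval x : Polynomial B →ₐ[B] S).restrictScalars k) H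
      refine hc.trans ?_
      congr 2
      ext i
      simp [l, ← IsScalarTower.algebraMap_apply]
    rw [this, mul_zero]

/-! ### Linear projections of affine space -/

section Projection

variable {k : Type*} [Field k] {m : ℕ}

/-- The inclusion of the coordinate ring of the linear projection of affine space along the
direction `v` (where `v 0 = 1`). -/
noncomputable def linearProjection (v : Fin (m + 1) → k) :
    MvPolynomial (Fin m) k →ₐ[k] MvPolynomial (Fin (m + 1)) k :=
  MvPolynomial.aeval fun i => MvPolynomial.X i.succ - MvPolynomial.C (v i.succ) * MvPolynomial.X 0

theorem linearProjection_X (v : Fin (m + 1) → k) (i : Fin m) :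
    linearProjection v (MvPolynomial.X i) =
      MvPolynomial.X i.succ - MvPolynomial.C (v i.succ) * MvPolynomial.X 0 := by
  simp [linearProjection]

theorem linearProjection_injective (v : Fin (m + 1) → k) :
    Function.Injective (linearProjection v) := by
  -- Restriction to the hyperplane x₀ = 0, which the projection maps isomorphically onto its target.
  let τ : MvPolynomial (Fin (m + 1)) k →ₐ[k] MvPolynomial (Fin m) k :=
    MvPolynomial.aeval (Fin.cons 0 MvPolynomial.X)
  have h : τ.comp (linearProjection v) = AlgHom.id k _ := by
    ext i
    simp [τ, linearProjection_X]
  exact Function.LeftInverse.injective (g := τ) fun x => DFunLike.congr_fun h x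

/-- Translation in the direction `v` fixes the polynomials pulled back along the projection. -/
theorem linearProjection_translate {v : Fin (m + 1) → k} (b : MvPolynomial (Fin m) k) (hv : v 0 = 1) :
    MvPolynomial.aeval (fun i => MvPolynomial.X i + MvPolynomial.C (v i)) (linearProjection v b) =
      linearProjection v b := by
  have h : (MvPolynomial.aeval (fun i => MvPolynomial.X i + MvPolynomial.C (v i))).comp
      (linearProjection v) = linearProjection v := by
    ext1 i
    simp [linearProjection_X, hv]
    ring
  exact DFunLike.congr_fun h b

/-- If the ideal `P` contains a homogeneous equation centred at `t` not vanishing on `v`, and `t`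
is not a zero of `P`, then the projection of `t` along `v` is not in the closure of the projection
of the zero locus of `P`. -/
theorem exists_linearProjection_mem_of_not_mem_zeroLocus {P : Ideal (MvPolynomial (Fin (m + 1)) k)}
    [P.IsPrime] {t v : Fin (m + 1) → k} (hv0 : v 0 = 1) {d : ℕ}
    {H : MvPolynomial (Fin (m + 1)) k} (hH : H.IsHomogeneous d)
    (hHP : MvPolynomial.aeval (fun i => MvPolynomial.X i - MvPolynomial.C (t i)) H ∈ P)
    (hv : MvPolynomial.eval v H ≠ 0) {a : MvPolynomial (Fin (m + 1)) k} (haP : a ∈ P)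
    (hat : MvPolynomial.eval t a ≠ 0) :
    ∃ b, linearProjection v b ∈ P ∧ MvPolynomial.eval t (linearProjection v b) ≠ 0 := by
  by_contra! hcon
  let A := MvPolynomial (Fin (m + 1)) k
  let B := MvPolynomial (Fin m) k
  let φ : B →ₐ[k] A ⧸ P := (Ideal.Quotient.mkₐ k P).comp (linearProjection v)
  let : Algebra B (A ⧸ P) := φ.toRingHom.toAlgebra
  have : IsScalarTower k B (A ⧸ P) := .of_algebraMap_eq fun c => (φ.commutes c).symm
  let z : Fin (m + 1) → A := fun i => MvPolynomial.X i - MvPolynomial.C (t i)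
  -- The components of z - v z₀, which are constant along `v`; the one of index 0 vanishes because
  -- `v 0 = 1`.
  let w : Fin (m + 1) → B :=
    Fin.cons 0 fun i => MvPolynomial.X i - MvPolynomial.C (t i.succ - v i.succ * t 0)
  have hw (i) : linearProjection v (w i) = z i - MvPolynomial.C (v i) * z 0 := by
    refine Fin.cases ?_ (fun i => ?_) i
    · simp [w, z, hv0]
    · simp only [w, z, Fin.cons_succ, map_sub, linearProjection_X, map_mul]
      have (c : k) : linearProjection v (MvPolynomial.C c) = MvPolynomial.C c :=
        (linearProjection v).commutes c
      simp only [this]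
      ring
  have hint0 : IsIntegral B (Ideal.Quotient.mkₐ k P (z 0)) := by
    refine isIntegral_of_isHomogeneous_aeval_eq_zero hH hv w _ ?_
    rw [← Ideal.Quotient.eq_zero_iff_mem] at hHP
    refine Eq.trans ?_ hHP
    have hc := MvPolynomial.comp_aeval_apply z (Ideal.Quotient.mkₐ k P) H
    refine Eq.trans ?_ hc.symm
    congr 2
    ext i
    change Ideal.Quotient.mkₐ k P (linearProjection v (w i)) + _ = _
    rw [hw, map_sub, map_mul]
    simp only [sub_add_eq_add_sub]
    rw [sub_eq_iff_eq_add]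
    rfl
  have : Algebra.IsIntegral B (A ⧸ P) := by
    have hC (c : k) : IsIntegral B (Ideal.Quotient.mkₐ k P (MvPolynomial.C c)) := by
      have : Ideal.Quotient.mkₐ k P (MvPolynomial.C c) = algebraMap B _ (algebraMap k B c) := by
        rw [← IsScalarTower.algebraMap_apply]
        exact (Ideal.Quotient.mkₐ k P).commutes c
      rw [this]
      exact isIntegral_algebraMap
    have hX (i) : IsIntegral B (Ideal.Quotient.mkₐ k P (MvPolynomial.X i)) := by
      have : (MvPolynomial.X i : A) =
          linearProjection v (w i) + MvPolynomial.C (v i) * z 0 + MvPolynomial.C (t i) := by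
        rw [hw]; simp [z]
      rw [this, map_add, map_add, map_mul]
      exact ((isIntegral_algebraMap (R := B) (x := w i)).add ((hC _).mul hint0)).add (hC _)
    refine ⟨fun y => ?_⟩
    obtain ⟨p, rfl⟩ := Ideal.Quotient.mkₐ_surjective k P y
    induction p using MvPolynomial.induction_on with
    | C c => exact hC c
    | add p q hp hq => rw [map_add]; exact hp.add hq
    | mul_X p i hp => rw [map_mul]; exact hp.mul (hX i)
  let ev : B →+* k := (MvPolynomial.eval t).comp (linearProjection v).toRingHom
  have hev : (RingHom.ker ev).IsPrime := RingHom.ker_isPrime ev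
  -- By `hcon` the kernel of `B → A ⧸ P` lies in the ideal of the projection of `t`. Lying over then
  -- yields `Q`, a point of the zero locus of `P` with the same projection as `t`.
  obtain ⟨Q, -, hQ, hQe⟩ := Ideal.exists_ideal_over_prime_of_isIntegral (RingHom.ker ev)
    (⊥ : Ideal (A ⧸ P)) (by
      intro b hb
      exact hcon b (Ideal.Quotient.eq_zero_iff_mem.mp hb))
  let π : A →+* (A ⧸ P) ⧸ Q := (Ideal.Quotient.mk Q).comp (Ideal.Quotient.mk P)
  have hπw (i) : π (z i) = π (MvPolynomial.C (v i)) * π (z 0) := by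
    rw [← map_mul, ← sub_eq_zero, ← map_sub, ← hw]
    refine Ideal.Quotient.eq_zero_iff_mem.mpr ?_
    have : w i ∈ Q.comap (algebraMap B (A ⧸ P)) := by
      rw [hQe, RingHom.mem_ker]
      change MvPolynomial.eval t (linearProjection v (w i)) = 0
      rw [hw]
      simp [z]
    exact this
  let πa : A →ₐ[k] (A ⧸ P) ⧸ Q := (Ideal.Quotient.mkₐ k Q).comp (Ideal.Quotient.mkₐ k P)
  have hπC (c : k) : π (MvPolynomial.C c) = algebraMap k _ c := πa.commutes c
  -- At `Q` one has z = z₀ v, so H(z) = 0 reads z₀^d H(v) = 0. Thus `Q` is the point `t` itself,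
  -- where `a` does not vanish.
  have hz0 : π (z 0) = 0 := by
    have h1 : πa (MvPolynomial.aeval z H) = 0 := by
      change Ideal.Quotient.mk Q (Ideal.Quotient.mk P _) = 0
      rw [Ideal.Quotient.eq_zero_iff_mem.mpr hHP, map_zero]
    rw [MvPolynomial.comp_aeval_apply] at h1
    have h2 : (fun i => πa (z i)) = fun i => πa (z 0) * algebraMap k _ (v i) := by
      ext i
      rw [mul_comm]
      exact (hπw i).trans (by rw [hπC]; rfl)
    rw [h2, hH.aeval_mul] at h1
    have h3 : MvPolynomial.aeval (fun i => algebraMap k ((A ⧸ P) ⧸ Q) (v i)) H =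
        algebraMap k _ (MvPolynomial.eval v H) :=
      (MvPolynomial.aeval_algebraMap_apply ((A ⧸ P) ⧸ Q) v H).trans (by simp)
    rw [h3] at h1
    rcases mul_eq_zero.mp h1 with h | h
    · exact eq_zero_of_pow_eq_zero h
    · exact absurd ((map_eq_zero _).mp h) hv
  have hX : πa = (Algebra.ofId k _).comp (MvPolynomial.aeval t) := by
    ext i
    have : π (z i) = 0 := by rw [hπw, hz0, mul_zero]
    simp only [z, map_sub, sub_eq_zero, hπC] at this
    simpa [Algebra.ofId_apply] using! this
  have h1 : πa a = 0 := by
    change Ideal.Quotient.mk Q (Ideal.Quotient.mk P _) = 0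
    rw [Ideal.Quotient.eq_zero_iff_mem.mpr haP, map_zero]
  rw [hX] at h1
  exact hat ((map_eq_zero (algebraMap k ((A ⧸ P) ⧸ Q))).mp h1)

end Projection

/-! ### Birational maps in terms of fractions -/

section Birational

variable {k A R : Type*} [Field k] [CommRing A] [CommRing R] [IsDomain R] [Algebra k A] [Algebra k R]

/-- The elements of `R` that are quotients of elements of the image of `ψ`. -/
def AlgHom.fractionSubalgebra (ψ : A →ₐ[k] R) : Subalgebra k R where
  carrier := {z | ∃ b, ψ b ≠ 0 ∧ ∃ a, ψ b * z = ψ a}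
  mul_mem' := by
    rintro z w ⟨b, hb, a, h⟩ ⟨b', hb', a', h'⟩
    refine ⟨b * b', by simp [hb, hb'], a * a', ?_⟩
    rw [map_mul, map_mul, ← h, ← h']
    ring
  add_mem' := by
    rintro z w ⟨b, hb, a, h⟩ ⟨b', hb', a', h'⟩
    refine ⟨b * b', by simp [hb, hb'], a * b' + b * a', ?_⟩
    rw [map_mul, map_add, map_mul, map_mul, ← h, ← h']
    ring
  algebraMap_mem' c := ⟨1, by simp, algebraMap k A c, by simp⟩

theorem AlgHom.apply_mem_fractionSubalgebra (ψ : A →ₐ[k] R) (a : A) :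
    ψ a ∈ ψ.fractionSubalgebra := ⟨1, by simp, a, by simp⟩

theorem AlgHom.mem_fractionSubalgebra_of_mul_mem {ψ : A →ₐ[k] R} {z w : R}
    (hz : z ∈ ψ.fractionSubalgebra) (h0 : z ≠ 0) (h : z * w ∈ ψ.fractionSubalgebra) :
    w ∈ ψ.fractionSubalgebra := by
  obtain ⟨b, hb, a, e⟩ := hz
  obtain ⟨b', hb', a', e'⟩ := h
  refine ⟨b' * a, ?_, b * a', ?_⟩
  · rw [map_mul, ← e]
    exact mul_ne_zero hb' (mul_ne_zero hb h0)
  · rw [map_mul, map_mul, ← e', ← e]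
    ring

/-- A map out of a polynomial ring that is birational onto an algebra of the same transcendence
degree is injective. -/
theorem AlgHom.injective_of_fractionSubalgebra_eq_top {n : ℕ}
    (ψ : MvPolynomial (Fin n) k →ₐ[k] R) (h : ψ.fractionSubalgebra = ⊤)
    (hn : (n : Cardinal) ≤ Algebra.trdeg k R) : Function.Injective ψ := by
  have hψ : ψ = MvPolynomial.aeval (fun i => ψ (MvPolynomial.X i)) := by
    ext i; simp
  have hr : Algebra.adjoin k (Set.range fun i => ψ (MvPolynomial.X i)) = ψ.range := by
    rw [← Algebra.map_top, ← MvPolynomial.adjoin_range_X, AlgHom.map_adjoin, ← Set.range_comp]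
    rfl
  have : Algebra.IsAlgebraic (Algebra.adjoin k (Set.range fun i => ψ (MvPolynomial.X i))) R := by
    rw [hr]
    refine ⟨fun z => ?_⟩
    obtain ⟨b, hb, a, e⟩ : z ∈ ψ.fractionSubalgebra := h ▸ Algebra.mem_top
    -- A fraction is a root of a linear polynomial with leading coefficient `ψ b`.
    refine ⟨Polynomial.C ⟨ψ b, b, rfl⟩ * Polynomial.X - Polynomial.C ⟨ψ a, a, rfl⟩, ?_, ?_⟩
    · intro h0
      have := congrArg (fun p => Polynomial.coeff p 1) h0
      simp only [Polynomial.coeff_sub, Polynomial.coeff_C_mul, Polynomial.coeff_X_one,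
        Polynomial.coeff_C_succ, Polynomial.coeff_zero, mul_one, sub_zero] at this
      exact hb (congrArg Subtype.val this)
    · simp only [map_sub, map_mul, Polynomial.aeval_C, Polynomial.aeval_X]
      exact sub_eq_zero.mpr e
  have hT := Algebra.IsAlgebraic.isTranscendenceBasis_of_lift_le_trdeg_of_finite k
    (fun i => ψ (MvPolynomial.X i)) (by simpa using hn)
  have := hT.1
  rw [AlgebraicIndependent, ← hψ] at this
  exact this

end Birational

/-! ### Choice of the direction of projection -/

/-- There is a direction along which finitely many incomparable primes of small dimension project
to incomparable primes. -/
theorem exists_linearProjection_separating {k : Type*} [Field k] [IsAlgClosed k] {m s : ℕ}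
    (P : Fin s → Ideal (MvPolynomial (Fin (m + 1)) k)) [∀ i, (P i).IsPrime]
    (hdim : ∀ i, Algebra.trdeg k (MvPolynomial (Fin (m + 1)) k ⧸ P i) + 1 < (m + 1 : ℕ))
    (hinc : ∀ i j, i ≠ j → ¬ P i ≤ P j) :
    ∃ v : Fin (m + 1) → k, v 0 = 1 ∧ ∀ i j, i ≠ j →
      ∃ b, linearProjection v b ∈ P i ∧ linearProjection v b ∉ P j := by
  -- Diagonal pairs also receive a form `H`, so that a single product over all pairs can be used;
  -- the separation clause is empty for them.
  have key (p : Fin s × Fin s) : ∃ (t : Fin (m + 1) → k) (d : ℕ)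
      (H : MvPolynomial (Fin (m + 1)) k), H ≠ 0 ∧ H.IsHomogeneous d ∧
      MvPolynomial.aeval (fun i => MvPolynomial.X i - MvPolynomial.C (t i)) H ∈ P p.1 ∧
      (p.1 ≠ p.2 → (∀ b ∈ P p.2, MvPolynomial.eval t b = 0) ∧
        ∃ a ∈ P p.1, MvPolynomial.eval t a ≠ 0) := by
    obtain ⟨t, ht⟩ : ∃ t : Fin (m + 1) → k, p.1 ≠ p.2 →
        (∀ b ∈ P p.2, MvPolynomial.eval t b = 0) ∧ ∃ a ∈ P p.1, MvPolynomial.eval t a ≠ 0 := by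
      by_cases hp : p.1 = p.2
      · exact ⟨0, fun h => absurd hp h⟩
      obtain ⟨a, ha, ha'⟩ := SetLike.not_le_iff_exists.mp (hinc _ _ hp)
      -- Nullstellensatz: a function outside the prime `P p.2` is nonzero at some point `t` of its
      -- zero locus.
      have hrad := (inferInstance : (P p.2).IsPrime).radical
      rw [← MvPolynomial.vanishingIdeal_zeroLocus_eq_radical (K := k)] at hrad
      rw [← hrad, MvPolynomial.mem_vanishingIdeal_iff] at ha'
      push Not at ha'
      obtain ⟨t, ht, hta⟩ := ha'
      refine ⟨t, fun _ => ⟨fun b hb => ?_, a, ha, ?_⟩⟩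
      · simpa [MvPolynomial.aeval_eq_eval] using ht b hb
      · simpa [MvPolynomial.aeval_eq_eval] using hta
    obtain ⟨d, H, hH0, hH, hHz⟩ := exists_isHomogeneous_aeval_eq_zero (hdim p.1)
      (fun i => Ideal.Quotient.mkₐ k (P p.1) (MvPolynomial.X i - MvPolynomial.C (t i)))
    refine ⟨t, d, H, hH0, hH, ?_, ht⟩
    rw [← Ideal.Quotient.eq_zero_iff_mem, ← hHz]
    exact MvPolynomial.comp_aeval_apply _ (Ideal.Quotient.mkₐ k (P p.1)) H
  choose t d H hH0 hH hHP hsep using key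
  -- The factor `X 0` forces `v 0 ≠ 0`, so `v` can be rescaled to `v 0 = 1`; by homogeneity the
  -- forms stay nonzero there.
  obtain ⟨v, hv⟩ : ∃ v, MvPolynomial.eval v (MvPolynomial.X 0 * ∏ p, H p) ≠ 0 := by
    by_contra! hc
    have : MvPolynomial.X 0 * ∏ p, H p = 0 := MvPolynomial.funext fun v => by rw [hc, map_zero]
    exact mul_ne_zero (MvPolynomial.X_ne_zero 0) (Finset.prod_ne_zero_iff.mpr fun p _ => hH0 p) this
  rw [map_mul, map_prod, MvPolynomial.eval_X] at hv
  have hv0 : v 0 ≠ 0 := left_ne_zero_of_mul hv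
  refine ⟨fun i => (v 0)⁻¹ * v i, inv_mul_cancel₀ hv0, fun i j hij => ?_⟩
  obtain ⟨hj, a, ha, hat⟩ := hsep (i, j) hij
  obtain ⟨b, hb, hbt⟩ := exists_linearProjection_mem_of_not_mem_zeroLocus
    (v := fun i => (v 0)⁻¹ * v i) (inv_mul_cancel₀ hv0) (hH (i, j)) (hHP (i, j)) (by
      have := (hH (i, j)).aeval_mul (v 0)⁻¹ v
      rw [MvPolynomial.aeval_eq_eval, MvPolynomial.aeval_eq_eval] at this
      refine ne_of_eq_of_ne this (mul_ne_zero (pow_ne_zero _ (inv_ne_zero hv0)) ?_)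
      exact (Finset.prod_ne_zero_iff.mp (right_ne_zero_of_mul hv)) (i, j) (Finset.mem_univ _))
    ha hat
  exact ⟨b, hb, fun h => hbt (hj _ h)⟩

/-! ### The triangular birational map -/

/-- The birational self-map of affine space `(x₀, x) ↦ (y₀, y)` with `y₀ = f x₀ + N / D` and
`y = (x - v x₀) ∏ (y₀ - cᵢ)`, where `f`, `N`, `D` are constant in the direction `v`. -/
theorem fractionSubalgebra_eq_top_of_triangular {k R : Type*} [Field k] {m : ℕ}
    [CommRing R] [IsDomain R] [Algebra k R] [Algebra (MvPolynomial (Fin (m + 1)) k) R]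
    [IsScalarTower k (MvPolynomial (Fin (m + 1)) k) R] {v : Fin (m + 1) → k}
    {f N D : MvPolynomial (Fin m) k} [IsLocalization.Away (linearProjection v D) R]
    (hf : f ≠ 0) (hD : D ≠ 0) {M : Polynomial k}
    {ψ : MvPolynomial (Fin (m + 1)) k →ₐ[k] R}
    (h0 : algebraMap _ R (linearProjection v D) * ψ (MvPolynomial.X 0) =
      algebraMap _ R (linearProjection v D * linearProjection v f * MvPolynomial.X 0 +
        linearProjection v N))
    (hM : Polynomial.aeval (ψ (MvPolynomial.X 0)) M ≠ 0)
    (hsucc : ∀ i : Fin m, ψ (MvPolynomial.X i.succ) =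
      algebraMap _ R (linearProjection v (MvPolynomial.X i)) *
        Polynomial.aeval (ψ (MvPolynomial.X 0)) M) :
    ψ.fractionSubalgebra = ⊤ := by
  let A := MvPolynomial (Fin (m + 1)) k
  let ι : A →ₐ[k] R := IsScalarTower.toAlgHom k A R
  have hD0 : linearProjection v D ≠ 0 := (map_ne_zero_iff _ (linearProjection_injective v)).mpr hD
  have hf0 : linearProjection v f ≠ 0 := (map_ne_zero_iff _ (linearProjection_injective v)).mpr hf
  have hι : Function.Injective ι :=
    IsLocalization.injective R (powers_le_nonZeroDivisors_of_noZeroDivisors hD0)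
  have hMmem : Polynomial.aeval (ψ (MvPolynomial.X 0)) M ∈ ψ.fractionSubalgebra := by
    rw [Polynomial.aeval_algHom_apply]
    exact ψ.apply_mem_fractionSubalgebra _
  -- The coordinates of the projection are recovered first, dividing by `M` at y₀; only then can the
  -- equation for y₀ be solved for x₀.
  have hB (b : MvPolynomial (Fin m) k) : ι (linearProjection v b) ∈ ψ.fractionSubalgebra := by
    induction b using MvPolynomial.induction_on with
    | C c =>
      have : ι (linearProjection v (MvPolynomial.C c)) = algebraMap k R c :=
        (ι.comp (linearProjection v)).commutes c
      rw [this]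
      exact Subalgebra.algebraMap_mem _ c
    | add p q hp hq => rw [map_add, map_add]; exact add_mem hp hq
    | mul_X p i hp =>
      rw [map_mul, map_mul]
      refine mul_mem hp (AlgHom.mem_fractionSubalgebra_of_mul_mem hMmem hM ?_)
      rw [mul_comm, show ι _ * _ = _ from (hsucc i).symm]
      exact ψ.apply_mem_fractionSubalgebra _
  have hX0 : ι (MvPolynomial.X 0) ∈ ψ.fractionSubalgebra := by
    have h1 : ι (linearProjection v D * linearProjection v f) * ι (MvPolynomial.X 0) =
        ι (linearProjection v D) * ψ (MvPolynomial.X 0) - ι (linearProjection v N) := by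
      rw [← map_mul, eq_sub_iff_add_eq, ← map_add]
      exact h0.symm
    refine AlgHom.mem_fractionSubalgebra_of_mul_mem
      (z := ι (linearProjection v D * linearProjection v f)) ?_ ?_ ?_
    · rw [map_mul]
      exact mul_mem (hB D) (hB f)
    · exact (map_ne_zero_iff _ hι).mpr (mul_ne_zero hD0 hf0)
    · rw [h1]
      exact sub_mem (mul_mem (hB D) (ψ.apply_mem_fractionSubalgebra _)) (hB N)
  have hA (a : A) : ι a ∈ ψ.fractionSubalgebra := by
    have hC (c : k) : ι (MvPolynomial.C c) ∈ ψ.fractionSubalgebra := by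
      have : ι (MvPolynomial.C c) = algebraMap k R c := ι.commutes c
      rw [this]
      exact Subalgebra.algebraMap_mem _ c
    induction a using MvPolynomial.induction_on with
    | C c => exact hC c
    | add p q hp hq => rw [map_add]; exact add_mem hp hq
    | mul_X p i hp =>
      rw [map_mul]
      refine mul_mem hp (Fin.cases hX0 (fun i => ?_) i)
      have : (MvPolynomial.X i.succ : A) = linearProjection v (MvPolynomial.X i) +
          MvPolynomial.C (v i.succ) * MvPolynomial.X 0 := by
        rw [linearProjection_X]; ring
      rw [this, map_add, map_mul]
      exact add_mem (hB _) (mul_mem (hC _) hX0)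
  rw [eq_top_iff]
  rintro z -
  obtain ⟨n, a, ha⟩ := IsLocalization.Away.surj (linearProjection v D) z
  refine AlgHom.mem_fractionSubalgebra_of_mul_mem (z := ι (linearProjection v D) ^ n)
    (pow_mem (hA _) n) (pow_ne_zero _ ((map_ne_zero_iff _ hι).mpr hD0)) ?_
  rw [mul_comm, show z * ι _ ^ n = _ from ha]
  exact hA a

/-- Finitely many incomparable primes of dimension at most `m - 1` in a polynomial ring in `m + 1`
variables can be contracted to distinct rational points by a birational map. -/
theorem exists_contracting_algHom {k : Type*} [Field k] [IsAlgClosed k] {m s : ℕ} [NeZero s]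
    (P : Fin s → Ideal (MvPolynomial (Fin (m + 1)) k)) [∀ i, (P i).IsPrime]
    (hdim : ∀ i, Algebra.trdeg k (MvPolynomial (Fin (m + 1)) k ⧸ P i) + 1 < (m + 1 : ℕ))
    (hinc : ∀ i j, i ≠ j → ¬ P i ≤ P j) {c : Fin s → k} (hc : Function.Injective c) :
    ∃ D, (∀ i, D ∉ P i) ∧
      ∃ ψ : MvPolynomial (Fin (m + 1)) k →ₐ[k] Localization.Away D,
        Function.Injective ψ ∧ (∀ z, ∃ b, ψ b ≠ 0 ∧ ∃ a, ψ b * z = ψ a) ∧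
        ∃ q : Fin s → Fin (m + 1) → k, Function.Injective q ∧
          ∀ i l, ψ (MvPolynomial.X l - MvPolynomial.C (q i l)) ∈
            (P i).map (algebraMap _ (Localization.Away D)) := by
  obtain ⟨v, hv0, hv⟩ := exists_linearProjection_separating P hdim hinc
  have hb (p : Fin s × Fin s) : ∃ b, p.1 ≠ p.2 →
      linearProjection v b ∈ P p.1 ∧ linearProjection v b ∉ P p.2 := by
    by_cases hp : p.1 = p.2
    · exact ⟨0, fun h => absurd hp h⟩
    · obtain ⟨b, hb⟩ := hv _ _ hp
      exact ⟨b, fun _ => hb⟩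
  choose b hb using hb
  -- The transcendence degree is less than `m`, so no V_i dominates the target of the projection.
  have hf (i : Fin s) : ∃ f, f ≠ 0 ∧ linearProjection v f ∈ P i := by
    have hlt : Algebra.trdeg k (MvPolynomial (Fin (m + 1)) k ⧸ P i) < m := by
      have := hdim i
      obtain ⟨n, hn⟩ := Cardinal.lt_aleph0.mp
        ((self_le_add_right _ 1).trans_lt (this.trans (Cardinal.natCast_lt_aleph0)))
      rw [hn] at this ⊢
      norm_cast at this ⊢
      omega
    obtain ⟨f, hf, hf0⟩ := exists_ne_zero_map_eq_zero_of_trdeg_lt hlt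
      ((Ideal.Quotient.mkₐ k (P i)).comp (linearProjection v))
    exact ⟨f, hf, Ideal.Quotient.eq_zero_iff_mem.mp hf0⟩
  choose f hf0 hfP using hf
  let F := ∏ i, f i
  have hF0 : F ≠ 0 := Finset.prod_ne_zero_iff.mpr fun i _ => hf0 i
  have hFP (i) : linearProjection v F ∈ P i := by
    rw [map_prod]
    exact Ideal.mem_of_dvd _ (Finset.dvd_prod_of_mem _ (Finset.mem_univ i)) (hfP i)
  -- `h i` vanishes on V_j for every j ≠ i but not identically on V_i. Hence `N / D0`, with `D0 = ∑
  -- h i` and `N = ∑ c i h i`, restricts to `c i` on V_i.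
  let h : Fin s → MvPolynomial (Fin m) k := fun i => ∏ j ∈ Finset.univ.erase i, b (j, i)
  have hhi (i) : linearProjection v (h i) ∉ P i := by
    rw [map_prod, Ideal.IsPrime.prod_mem_iff]
    rintro ⟨j, hj, hjP⟩
    exact (hb (j, i) (Finset.ne_of_mem_erase hj)).2 hjP
  have hhj (i j) (hij : j ≠ i) : linearProjection v (h i) ∈ P j := by
    rw [map_prod]
    exact Ideal.mem_of_dvd _ (Finset.dvd_prod_of_mem _
      (Finset.mem_erase.mpr ⟨hij, Finset.mem_univ j⟩)) (hb (j, i) hij).1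
  let D0 := ∑ i, h i
  let N := ∑ i, MvPolynomial.C (c i) * h i
  have hD0P (i) : linearProjection v D0 ∉ P i := by
    rw [map_sum, ← Finset.add_sum_erase _ _ (Finset.mem_univ i)]
    intro hm
    refine hhi i ((Ideal.add_mem_iff_left _ (Ideal.sum_mem _ fun j hj => ?_)).mp hm)
    exact hhj j i (Finset.ne_of_mem_erase hj).symm
  have hD0 : D0 ≠ 0 := by
    intro h0
    refine hD0P 0 ?_
    rw [h0, map_zero]
    exact zero_mem _
  have hD : linearProjection v D0 ≠ 0 :=
    (map_ne_zero_iff _ (linearProjection_injective v)).mpr hD0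
  have hlC (a : k) : linearProjection v (MvPolynomial.C a) = MvPolynomial.C a :=
    (linearProjection v).commutes a
  have hN (i) : linearProjection v N - MvPolynomial.C (c i) * linearProjection v D0 ∈ P i := by
    rw [← hlC, ← map_mul, ← map_sub, Finset.mul_sum, ← Finset.sum_sub_distrib, map_sum]
    refine Ideal.sum_mem _ fun j _ => ?_
    rw [← sub_mul, map_mul]
    by_cases hij : i = j
    · simp [hij]
    · exact Ideal.mul_mem_left _ _ (hhj j i hij)
  refine ⟨linearProjection v D0, hD0P, ?_⟩
  let A := MvPolynomial (Fin (m + 1)) k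
  let R := Localization.Away (linearProjection v D0)
  have hinj : Function.Injective (algebraMap A R) :=
    IsLocalization.injective R (powers_le_nonZeroDivisors_of_noZeroDivisors hD)
  have : IsDomain R := IsLocalization.isDomain_localization
    (powers_le_nonZeroDivisors_of_noZeroDivisors hD)
  let D' : R := algebraMap A R (linearProjection v D0)
  let Di : R := IsLocalization.Away.invSelf (linearProjection v D0)
  have hDi : D' * Di = 1 := IsLocalization.Away.mul_invSelf _
  -- The term in `F` makes y₀ depend on x₀ without changing its value `c i` on V_i.
  let y0 : R := Di * algebraMap A R (linearProjection v D0 * linearProjection v F *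
    MvPolynomial.X 0 + linearProjection v N)
  let M : Polynomial k := ∏ i, (Polynomial.X - Polynomial.C (c i))
  have hDy : D' * y0 = algebraMap A R (linearProjection v D0 * linearProjection v F *
    MvPolynomial.X 0 + linearProjection v N) := by rw [← mul_assoc, hDi, one_mul]
  have hDyc (a : k) : D' * (y0 - algebraMap k R a) =
      algebraMap A R (linearProjection v D0 * linearProjection v F * MvPolynomial.X 0 +
        (linearProjection v N - MvPolynomial.C a * linearProjection v D0)) := by
    rw [mul_sub, hDy, IsScalarTower.algebraMap_apply k A R, ← map_mul (algebraMap A R),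
      ← map_sub (algebraMap A R)]
    congr 1
    rw [MvPolynomial.algebraMap_eq]
    ring
  have hyP (i) : y0 - algebraMap k R (c i) ∈ (P i).map (algebraMap A R) := by
    have : y0 - algebraMap k R (c i) = Di * (D' * (y0 - algebraMap k R (c i))) := by
      rw [← mul_assoc, mul_comm Di, hDi, one_mul]
    rw [this, hDyc]
    refine Ideal.mul_mem_left _ _ (Ideal.mem_map_of_mem _ (add_mem ?_ (hN i)))
    exact Ideal.mul_mem_right _ _ (Ideal.mul_mem_left _ _ (hFP i))
  have hMP (i) : Polynomial.aeval y0 M ∈ (P i).map (algebraMap A R) := by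
    rw [map_prod]
    refine Ideal.mem_of_dvd _ (Finset.dvd_prod_of_mem _ (Finset.mem_univ i)) ?_
    simpa using hyP i
  have hM : Polynomial.aeval y0 M ≠ 0 := by
    rw [map_prod]
    refine Finset.prod_ne_zero_iff.mpr fun i _ h0 => ?_
    rw [map_sub, Polynomial.aeval_X, Polynomial.aeval_C] at h0
    have h1 := hDyc (c i)
    rw [h0, mul_zero, eq_comm, map_eq_zero_iff _ hinj, ← hlC, ← map_mul, ← map_mul, ← map_sub] at h1
    -- If y₀ were constant, translation by `v` would preserve the relation `h1`; it changes the left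
    -- side by `D0 * F`, which is nonzero.
    have h2 := congrArg (MvPolynomial.aeval fun i => MvPolynomial.X i + MvPolynomial.C (v i)) h1
    rw [map_add, map_mul, linearProjection_translate _ hv0, linearProjection_translate _ hv0,
      MvPolynomial.aeval_X, map_zero, mul_add, add_right_comm, h1, zero_add, hv0, map_one, mul_one,
      map_eq_zero_iff _ (linearProjection_injective v)] at h2
    exact mul_ne_zero hD0 hF0 h2
  -- The factor `M` at y₀ kills the remaining coordinates on every V_i, so the image is (c_i, 0).
  let ψ : A →ₐ[k] R := MvPolynomial.aeval (Fin.cons y0 fun i =>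
    algebraMap A R (linearProjection v (MvPolynomial.X i)) * Polynomial.aeval y0 M)
  have hψ0 : ψ (MvPolynomial.X 0) = y0 := MvPolynomial.aeval_X _ _
  have hψs (i : Fin m) : ψ (MvPolynomial.X i.succ) =
      algebraMap A R (linearProjection v (MvPolynomial.X i)) * Polynomial.aeval y0 M :=
    MvPolynomial.aeval_X _ _
  have htop : ψ.fractionSubalgebra = ⊤ := by
    refine fractionSubalgebra_eq_top_of_triangular (v := v) (N := N) (M := M) hF0 hD0 ?_ ?_ ?_
    · rw [hψ0]; exact hDy
    · rw [hψ0]; exact hM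
    · intro i; rw [hψ0]; exact hψs i
  have hψinj : Function.Injective ψ := by
    refine ψ.injective_of_fractionSubalgebra_eq_top htop ?_
    have := _root_.lift_trdeg_le_of_injective (IsScalarTower.toAlgHom k A R) hinj
    simpa [A] using this
  refine ⟨ψ, hψinj, fun z => ?_, fun i => Fin.cons (c i) 0, fun i j hij => hc ?_, fun i l => ?_⟩
  · have : z ∈ ψ.fractionSubalgebra := htop ▸ Algebra.mem_top
    exact this
  · simpa using congrFun hij 0
  · have hψC (a : k) : ψ (MvPolynomial.C a) = algebraMap k R a := ψ.commutes a
    refine Fin.cases ?_ (fun l => ?_) l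
    · rw [map_sub, hψ0, hψC]
      exact hyP i
    · rw [map_sub, hψs, hψC]
      beta_reduce
      rw [Fin.cons_succ, Pi.zero_apply, map_zero, sub_zero]
      exact Ideal.mul_mem_left _ _ (hMP i)

/-! ### From algebra maps to rational maps of schemes -/

/-- A birational injection of domains of finite type becomes a localization at one element after
inverting the image of that element. -/
theorem exists_isLocalization_away_comp {k A R : Type*} [Field k] [CommRing A] [IsDomain A]
    [CommRing R] [IsDomain R] [Algebra k A] [Algebra k R] [Algebra.FiniteType k R] (ψ : A →ₐ[k] R)
    (hψ : Function.Injective ψ) (h : ∀ z, ∃ b, ψ b ≠ 0 ∧ ∃ a, ψ b * z = ψ a) :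
    ∃ g : A, g ≠ 0 ∧ letI : Algebra A (Localization.Away (ψ g)) :=
      ((algebraMap R (Localization.Away (ψ g))).comp ψ.toRingHom).toAlgebra
      IsLocalization.Away g (Localization.Away (ψ g)) := by
  obtain ⟨t, ht⟩ := (inferInstance : Algebra.FiniteType k R).out
  choose b hb a ha using h
  let g := ∏ z ∈ t, b z
  have hg : g ≠ 0 := Finset.prod_ne_zero_iff.mpr fun z _ h0 => hb z (by rw [h0, map_zero])
  have hψg : ψ g ≠ 0 := (map_ne_zero_iff _ hψ).mpr hg
  refine ⟨g, hg, ?_⟩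
  -- `g` is a common denominator of the generators in `t`; hence powers of `ψ g` clear the
  -- denominators of all of `R`.
  let S : Subalgebra k R :=
    { carrier := {z | ∃ n, ∃ c, ψ g ^ n * z = ψ c}
      mul_mem' := by
        rintro z w ⟨n, c, e⟩ ⟨n', c', e'⟩
        refine ⟨n + n', c * c', ?_⟩
        rw [map_mul, ← e, ← e']
        ring
      add_mem' := by
        rintro z w ⟨n, c, e⟩ ⟨n', c', e'⟩
        refine ⟨n + n', g ^ n' * c + g ^ n * c', ?_⟩
        rw [map_add, map_mul, map_mul, ← e, ← e', map_pow, map_pow]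
        ring
      algebraMap_mem' := fun c => ⟨0, algebraMap k A c, by simp⟩ }
  have hS : S = ⊤ := by
    rw [eq_top_iff, ← ht, Algebra.adjoin_le_iff]
    intro z hz
    obtain ⟨c, hc⟩ := Finset.dvd_prod_of_mem b hz
    refine ⟨1, c * a z, ?_⟩
    rw [pow_one, map_mul, ← ha, show ψ g = ψ (b z * c) from congrArg ψ hc, map_mul]
    ring
  let L := Localization.Away (ψ g)
  have hinj : Function.Injective (algebraMap R L) :=
    IsLocalization.injective L (powers_le_nonZeroDivisors_of_noZeroDivisors hψg)
  let : Algebra A L := ((algebraMap R L).comp ψ.toRingHom).toAlgebra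
  have hmap (x : A) : algebraMap A L x = algebraMap R L (ψ x) := rfl
  change IsLocalization (Submonoid.powers g) L
  refine (isLocalization_iff _ _).mpr ⟨?_, fun z => ?_, fun {x y} hxy => ⟨1, ?_⟩⟩
  · rintro ⟨_, n, rfl⟩
    rw [hmap, map_pow, map_pow]
    exact (IsLocalization.Away.algebraMap_isUnit (ψ g)).pow n
  · obtain ⟨n, w, hw⟩ := IsLocalization.Away.surj (ψ g) z
    obtain ⟨l, c, hc⟩ : w ∈ S := hS ▸ Algebra.mem_top
    refine ⟨(c, ⟨g ^ (l + n), l + n, rfl⟩), ?_⟩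
    simp only [hmap]
    rw [← hc, map_mul, ← hw, map_pow, pow_add, map_mul, map_pow, map_pow]
    ring
  · rw [hψ (hinj hxy)]

namespace AlgebraicGeometry.Scheme

variable {X Y S U V : Scheme.{0}}

/-- The partial map given by a morphism out of a dense open subscheme. -/
noncomputable def PartialMap.ofOpenImmersion (j : V ⟶ X) [IsOpenImmersion j] [IsDominant j]
    (q : V ⟶ Y) : X.PartialMap Y where
  domain := j.opensRange
  dense_domain := j.denseRange
  hom := j.isoOpensRange.inv ≫ q

/-- The partial isomorphism given by two open immersions with dense image. -/
noncomputable def PartialIso.ofOpenImmersions (f₁ : U ⟶ X) (f₂ : U ⟶ Y) [IsOpenImmersion f₁]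
    [IsDominant f₁] [IsOpenImmersion f₂] [IsDominant f₂] : X.PartialIso Y where
  source := f₁.opensRange
  dense_source := f₁.denseRange
  target := f₂.opensRange
  dense_target := f₂.denseRange
  iso := f₁.isoOpensRange.symm ≪≫ f₂.isoOpensRange

theorem PartialIso.ofOpenImmersions_isOver (f₁ : U ⟶ X) (f₂ : U ⟶ Y) [IsOpenImmersion f₁]
    [IsDominant f₁] [IsOpenImmersion f₂] [IsDominant f₂] {sX : X ⟶ S} {sY : Y ⟶ S}
    (h : f₁ ≫ sX = f₂ ≫ sY) : (PartialIso.ofOpenImmersions f₁ f₂).IsOver sX sY := by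
  simp only [PartialIso.IsOver, PartialIso.ofOpenImmersions, Iso.trans_hom, Iso.symm_hom,
    Category.assoc, Hom.isoOpensRange_hom_ι_assoc]
  rw [← h, Hom.isoOpensRange_inv_comp_assoc]

/-- Two representatives of one rational map are needed: on `V` the contraction is visible, and on
the smaller `U` the map is an open immersion. -/
theorem PartialMap.toRationalMap_ofOpenImmersion (j : V ⟶ X) [IsOpenImmersion j] [IsDominant j]
    (q : V ⟶ Y) (f₁ : U ⟶ X) (f₂ : U ⟶ Y) [IsOpenImmersion f₁]
    [IsDominant f₁] [IsOpenImmersion f₂] [IsDominant f₂] (l : U ⟶ V) (h₁ : l ≫ j = f₁)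
    (h₂ : l ≫ q = f₂) :
    (PartialMap.ofOpenImmersion j q).toRationalMap =
      (PartialIso.ofOpenImmersions f₁ f₂).toRationalMap := by
  rw [PartialMap.toRationalMap_eq_iff]
  have hle : f₁.opensRange ≤ j.opensRange := by
    rintro _ ⟨u, rfl⟩
    exact ⟨l u, by rw [← Hom.comp_apply, h₁]⟩
  refine ⟨f₁.opensRange, f₁.denseRange, hle, le_rfl, ?_⟩
  have hl : f₁.isoOpensRange.hom ≫ X.homOfLE hle ≫ j.isoOpensRange.inv = l := by
    rw [← cancel_mono j]
    simp [h₁]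
  change X.homOfLE hle ≫ j.isoOpensRange.inv ≫ q =
    X.homOfLE le_rfl ≫ (f₁.isoOpensRange.inv ≫ f₂.isoOpensRange.hom) ≫ f₂.opensRange.ι
  rw [← cancel_epi f₁.isoOpensRange.hom, reassoc_of% hl, h₂]
  simp

/-- A partial map contracts the closure of a point as soon as it does so on an affine chart. -/
theorem PartialMap.contractsTo_ofOpenImmersion (j : V ⟶ X) [IsOpenImmersion j] [IsDominant j]
    (q : V ⟶ Y) {T : Set X} {y : Y} (hy : IsClosed ({y} : Set Y)) (hT : ∃ x, j x ∈ T)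
    (h : ∀ x, j x ∈ T → q x = y) : ContractsTo (PartialMap.ofOpenImmersion j q).toRationalMap T y := by
  refine ⟨hy, _, rfl, ?_⟩
  have hj (x : V) : (j.opensRange.ι (j.isoOpensRange.hom x)) = j x := by
    rw [← Hom.comp_apply, Hom.isoOpensRange_hom_ι]
  have hq (x : V) : (PartialMap.ofOpenImmersion j q).hom (j.isoOpensRange.hom x) = q x := by
    change (j.isoOpensRange.inv ≫ q) (j.isoOpensRange.hom x) = q x
    rw [← Hom.comp_apply, Iso.hom_inv_id_assoc]
  ext z
  constructor
  · rintro ⟨x, hx, rfl⟩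
    obtain ⟨x, rfl⟩ := j.isoOpensRange.hom.surjective x
    rw [hq]
    refine h x ?_
    rw [← hj]
    exact hx
  · rintro rfl
    obtain ⟨x, hx⟩ := hT
    refine ⟨j.isoOpensRange.hom x, ?_, (hq x).trans (h x hx)⟩
    change j.opensRange.ι _ ∈ T
    rw [hj]
    exact hx

end AlgebraicGeometry.Scheme

theorem isDominant_of_isOpenImmersion_of_irreducibleSpace {U X : Scheme.{0}} [IrreducibleSpace X]
    [Nonempty U] (f : U ⟶ X) [IsOpenImmersion f] : IsDominant f :=
  ⟨f.isOpenEmbedding.isOpen_range.dense (Set.range_nonempty _)⟩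

/-- The quotient map by such a prime factors through evaluation at `a`, and the ideal of a rational
point is maximal. -/
theorem MvPolynomial.pointToPoint_eq_of_mem {σ k : Type*} [Field k] {a : σ → k}
    {p : PrimeSpectrum (MvPolynomial σ k)}
    (h : ∀ i, MvPolynomial.X i - MvPolynomial.C (a i) ∈ p.asIdeal) :
    p = MvPolynomial.pointToPoint a := by
  have hle : MvPolynomial.vanishingIdeal k {a} ≤ p.asIdeal := by
    intro f hf
    rw [MvPolynomial.mem_vanishingIdeal_singleton_iff] at hf
    have : Ideal.Quotient.mkₐ k p.asIdeal =
        (Algebra.ofId k (MvPolynomial σ k ⧸ p.asIdeal)).comp (MvPolynomial.aeval a) := by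
      ext i
      have hi := Ideal.Quotient.eq_zero_iff_mem.mpr (h i)
      rw [map_sub, sub_eq_zero] at hi
      simpa using! hi
    refine Ideal.Quotient.eq_zero_iff_mem.mp ?_
    change Ideal.Quotient.mkₐ k p.asIdeal f = 0
    rw [this, AlgHom.comp_apply, hf, map_zero]
  exact PrimeSpectrum.ext (Ideal.IsMaximal.eq_of_le inferInstance p.2.ne_top hle).symm

theorem MvPolynomial.pointToPoint_injective {σ k : Type*} [Field k] :
    Function.Injective (MvPolynomial.pointToPoint : (σ → k) → PrimeSpectrum (MvPolynomial σ k)) := by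
  intro a b h
  ext i
  have ha : MvPolynomial.X i - MvPolynomial.C (a i) ∈ MvPolynomial.vanishingIdeal k {a} := by
    simp
  rw [show MvPolynomial.vanishingIdeal k {a} = MvPolynomial.vanishingIdeal k {b} from
    congrArg PrimeSpectrum.asIdeal h, MvPolynomial.mem_vanishingIdeal_singleton_iff] at ha
  simpa [sub_eq_zero, eq_comm] using ha

/-- If `X` has a dense open subscheme isomorphic to affine space, then finitely many points of
codimension at least two of this subscheme, none of which specializes to another, can be contracted
by a birational self-map of `X`. -/
theorem exists_birational_contracting_of_chart {m s : ℕ} [NeZero s] {X : Scheme.{0}}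
    [IrreducibleSpace X] [JacobsonSpace X] (sX : X ⟶ Spec (.of ℂ))
    (ι : Spec (.of (MvPolynomial (Fin (m + 1)) ℂ)) ⟶ X) [IsOpenImmersion ι]
    (hι : ι ≫ sX = Spec.map (CommRingCat.ofHom (algebraMap ℂ (MvPolynomial (Fin (m + 1)) ℂ))))
    (x : Fin s → PrimeSpectrum (MvPolynomial (Fin (m + 1)) ℂ))
    (hdim : ∀ i, Algebra.trdeg ℂ (MvPolynomial (Fin (m + 1)) ℂ ⧸ (x i).asIdeal) + 1 < (m + 1 : ℕ))
    (hinc : ∀ i j, i ≠ j → ¬ (x i).asIdeal ≤ (x j).asIdeal) :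
    ∃ ω : X ⤏ X, IsBirationalMapOver sX sX ω ∧ ∃ q : Fin s → X, Function.Injective q ∧
      ∀ i, ContractsTo ω (closure {ι (x i)}) (q i) := by
  let A := MvPolynomial (Fin (m + 1)) ℂ
  obtain ⟨D, hD, ψ, hψ, hbir, q, hq, hqP⟩ := exists_contracting_algHom (fun i => (x i).asIdeal)
    hdim hinc (c := fun i => ((i : ℕ) : ℂ)) (fun i j h => by simpa [Fin.ext_iff] using h)
  have hD0 : D ≠ 0 := fun h => hD 0 (h ▸ zero_mem _)
  let R := Localization.Away D
  have : IsDomain R := IsLocalization.isDomain_localization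
    (powers_le_nonZeroDivisors_of_noZeroDivisors hD0)
  have : Algebra.FiniteType A R := IsLocalization.finiteType_of_monoid_fg (Submonoid.powers D) R
  have : Algebra.FiniteType ℂ R := .trans (S := A) inferInstance inferInstance
  obtain ⟨g, hg, hgL⟩ := exists_isLocalization_away_comp ψ hψ hbir
  have hψg : ψ g ≠ 0 := (map_ne_zero_iff _ hψ).mpr hg
  let L := Localization.Away (ψ g)
  have : IsDomain L := IsLocalization.isDomain_localization
    (powers_le_nonZeroDivisors_of_noZeroDivisors hψg)
  let i₁ : Spec (.of R) ⟶ Spec (.of A) := Spec.map (CommRingCat.ofHom (algebraMap A R))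
  let l : Spec (.of L) ⟶ Spec (.of R) := Spec.map (CommRingCat.ofHom (algebraMap R L))
  let p : Spec (.of R) ⟶ Spec (.of A) := Spec.map (CommRingCat.ofHom ψ.toRingHom)
  have hi₁ : IsOpenImmersion i₁ := IsOpenImmersion.of_isLocalization D
  have hl : IsOpenImmersion l := IsOpenImmersion.of_isLocalization (ψ g)
  have hlp : IsOpenImmersion (l ≫ p) := by
    let : Algebra A L := ((algebraMap R L).comp ψ.toRingHom).toAlgebra
    have : IsLocalization.Away g L := hgL
    have h := IsOpenImmersion.of_isLocalization (R := A) (S := L) g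
    rw [show l ≫ p = Spec.map (CommRingCat.ofHom (algebraMap A L)) by
      rw [← Spec.map_comp, ← CommRingCat.ofHom_comp]]
    exact h
  have hneR : Nonempty (Spec (.of R)) := inferInstanceAs (Nonempty (PrimeSpectrum R))
  have hneL : Nonempty (Spec (.of L)) := inferInstanceAs (Nonempty (PrimeSpectrum L))
  let j := i₁ ≫ ι
  let f₁ := l ≫ i₁ ≫ ι
  let f₂ := (l ≫ p) ≫ ι
  have : IsDominant j := isDominant_of_isOpenImmersion_of_irreducibleSpace j
  have : IsDominant f₁ := isDominant_of_isOpenImmersion_of_irreducibleSpace f₁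
  have : IsDominant f₂ := isDominant_of_isOpenImmersion_of_irreducibleSpace f₂
  have hcomp : p ≫ ι ≫ sX = i₁ ≫ ι ≫ sX := by
    rw [hι, ← Spec.map_comp, ← Spec.map_comp, ← CommRingCat.ofHom_comp, ← CommRingCat.ofHom_comp]
    congr 2
    ext a
    · exact (ψ.commutes a).trans (IsScalarTower.algebraMap_apply ℂ A R a)
  have hr := Scheme.PartialMap.toRationalMap_ofOpenImmersion j (p ≫ ι) f₁ f₂ l rfl
    (Category.assoc _ _ _).symm
  refine ⟨(Scheme.PartialMap.ofOpenImmersion j (p ≫ ι)).toRationalMap,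
    ⟨Scheme.PartialIso.ofOpenImmersions f₁ f₂, ?_, hr.symm⟩,
    fun i => ι (MvPolynomial.pointToPoint (q i)), ?_, fun i => ?_⟩
  · refine Scheme.PartialIso.ofOpenImmersions_isOver f₁ f₂ ?_
    simp only [f₁, f₂, Category.assoc, hcomp]
  · exact ι.isOpenEmbedding.injective.comp (MvPolynomial.pointToPoint_injective.comp hq)
  · refine Scheme.PartialMap.contractsTo_ofOpenImmersion j (p ≫ ι) ?_ ?_ ?_
    · have hmem : (MvPolynomial.pointToPoint (q i) : PrimeSpectrum A) ∈
          closedPoints (PrimeSpectrum A) := by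
        rw [mem_closedPoints_iff, PrimeSpectrum.isClosed_singleton_iff_isMaximal]
        exact inferInstanceAs (MvPolynomial.vanishingIdeal ℂ {q i}).IsMaximal
      have := ι.isOpenEmbedding.preimage_closedPoints
      exact this.symm.subset hmem
    · have hx : x i ∈ Set.range (PrimeSpectrum.comap (algebraMap A R)) := by
        rw [PrimeSpectrum.localization_away_comap_range R D]
        exact hD i
      obtain ⟨z, hz⟩ := hx
      refine ⟨z, ?_⟩
      have : j z = ι (x i) := by
        rw [← hz]
        exact Scheme.Hom.comp_apply _ _ _
      rw [this]
      exact subset_closure rfl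
    · intro z hz
      have hjz : j z = ι (i₁ z) := Scheme.Hom.comp_apply _ _ _
      rw [hjz, ← specializes_iff_mem_closure] at hz
      have hle : (x i).asIdeal ≤ z.asIdeal.comap (algebraMap A R) :=
        (PrimeSpectrum.le_iff_specializes _ _).mpr
          (ι.isOpenEmbedding.isInducing.specializes_iff.mp hz)
      rw [Scheme.Hom.comp_apply]
      congr 1
      refine MvPolynomial.pointToPoint_eq_of_mem fun l' => ?_
      exact Ideal.map_le_iff_le_comap.mpr hle (hqP i l')

/-! ### Projective space and its affine charts -/

noncomputable section

section HomogeneousCoordinates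

variable {r : ℕ}

theorem algebraMap_homogeneousSubmodule_zero_surjective :
    Function.Surjective
      (algebraMap ℂ (MvPolynomial.homogeneousSubmodule (Fin (r + 1)) ℂ 0)) := by
  rintro ⟨p, hp⟩
  have hp' := hp
  rw [MvPolynomial.homogeneousSubmodule_zero] at hp'
  obtain ⟨c, rfl⟩ := hp'
  exact ⟨c, Subtype.ext (by simp [Algebra.algebraMap_eq_smul_one])⟩

instance : JacobsonSpace (ComplexProjectiveSpace r) := by
  have : IsJacobsonRing (MvPolynomial.homogeneousSubmodule (Fin (r + 1)) ℂ 0) :=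
    isJacobsonRing_of_surjective ⟨_, algebraMap_homogeneousSubmodule_zero_surjective⟩
  have : IsScalarTower ℂ (MvPolynomial.homogeneousSubmodule (Fin (r + 1)) ℂ 0)
      (MvPolynomial (Fin (r + 1)) ℂ) :=
    IsScalarTower.of_algebraMap_eq (R := ℂ) (S := MvPolynomial.homogeneousSubmodule _ ℂ 0)
      fun _ => rfl
  have : Algebra.FiniteType (MvPolynomial.homogeneousSubmodule (Fin (r + 1)) ℂ 0)
      (MvPolynomial (Fin (r + 1)) ℂ) := .of_restrictScalars_finiteType ℂ _ _
  have : LocallyOfFiniteType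
    (Proj.toSpecZero (MvPolynomial.homogeneousSubmodule (Fin (r + 1)) ℂ)) :=
    Proj.instLocallyOfFiniteTypeToSpecZeroOfFiniteTypeSubtypeMemOfNatNat _
  exact @LocallyOfFiniteType.jacobsonSpace _ _
    (Proj.toSpecZero (MvPolynomial.homogeneousSubmodule (Fin (r + 1)) ℂ)) this _

theorem MvPolynomial.X_mem_homogeneousSubmodule (i : Fin (r + 1)) :
    (MvPolynomial.X i : MvPolynomial (Fin (r + 1)) ℂ) ∈
      MvPolynomial.homogeneousSubmodule (Fin (r + 1)) ℂ 1 :=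
  MvPolynomial.isHomogeneous_X ℂ i

/-- The variables generate the polynomial ring over its degree zero part, so their basic opens cover
`Proj`. -/
theorem ProjectiveSpectrum.exists_X_notMem
    (x : ProjectiveSpectrum (MvPolynomial.homogeneousSubmodule (Fin (r + 1)) ℂ)) :
    ∃ i, MvPolynomial.X i ∉ x.asHomogeneousIdeal := by
  have h := Proj.iSup_basicOpen_eq_top' (MvPolynomial.homogeneousSubmodule (Fin (r + 1)) ℂ)
    (MvPolynomial.X : Fin (r + 1) → _) (fun i => ⟨1, MvPolynomial.X_mem_homogeneousSubmodule i⟩)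
    (by
      rw [eq_top_iff]
      rintro p -
      induction p using MvPolynomial.induction_on with
      | C c =>
        have : (MvPolynomial.C c : MvPolynomial (Fin (r + 1)) ℂ) =
            algebraMap (MvPolynomial.homogeneousSubmodule (Fin (r + 1)) ℂ 0) _
              ⟨MvPolynomial.C c, MvPolynomial.isHomogeneous_C _ c⟩ := rfl
        rw [this]
        exact Subalgebra.algebraMap_mem _ _
      | add p q hp hq => exact add_mem hp hq
      | mul_X p i hp => exact mul_mem hp (Algebra.subset_adjoin ⟨i, rfl⟩))
  have hx := h.ge (Set.mem_univ (x : Proj _))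
  obtain ⟨i, hi⟩ := Opens.mem_iSup.mp hx
  exact ⟨i, hi⟩

instance : IrreducibleSpace (ComplexProjectiveSpace r) := by
  have hprime : (⊥ : HomogeneousIdeal
      (MvPolynomial.homogeneousSubmodule (Fin (r + 1)) ℂ)).toIdeal.IsPrime := by
    rw [HomogeneousIdeal.toIdeal_bot]
    exact Ideal.isPrime_bot
  let η : ProjectiveSpectrum (MvPolynomial.homogeneousSubmodule (Fin (r + 1)) ℂ) :=
    ⟨⊥, hprime, fun h => by
      have hX : _ ∈ (⊥ : HomogeneousIdeal _).toIdeal := h (HomogeneousIdeal.mem_irrelevant_of_mem _ one_pos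
        (MvPolynomial.X_mem_homogeneousSubmodule (0 : Fin (r + 1))))
      rw [HomogeneousIdeal.toIdeal_bot, Ideal.mem_bot] at hX
      exact MvPolynomial.X_ne_zero _ hX⟩
  have hη : closure ({η} : Set (ProjectiveSpectrum _)) = Set.univ :=
    Set.eq_univ_of_forall fun x =>
      (ProjectiveSpectrum.le_iff_mem_closure _ η x).mp (bot_le (a := x.asHomogeneousIdeal))
  have hirr : IrreducibleSpace
      (ProjectiveSpectrum (MvPolynomial.homogeneousSubmodule (Fin (r + 1)) ℂ)) := by
    rw [irreducibleSpace_def, Set.top_eq_univ, ← hη]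
    exact isIrreducible_singleton.closure
  exact hirr

/-- Finitely many points of projective space lie in the complement of a common hyperplane. -/
theorem exists_linearForm_notMem {s : ℕ}
    (x : Fin s → ProjectiveSpectrum (MvPolynomial.homogeneousSubmodule (Fin (r + 1)) ℂ)) :
    ∃ a : Fin (r + 1) → ℂ, a 0 ≠ 0 ∧
      ∀ i, ∑ l, a l • (MvPolynomial.X l : MvPolynomial (Fin (r + 1)) ℂ) ∉
        (x i).asHomogeneousIdeal := by
  let Λ := Fintype.linearCombination ℂ (MvPolynomial.X : Fin (r + 1) → MvPolynomial (Fin (r + 1)) ℂ)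
  -- A vector space over an infinite field is not a finite union of proper subspaces. The index
  -- `none` adds the condition `a 0 ≠ 0`.
  let W : Option (Fin s) → Subspace ℂ (Fin (r + 1) → ℂ) := fun o => o.elim
    (LinearMap.ker (LinearMap.proj 0 : (Fin (r + 1) → ℂ) →ₗ[ℂ] ℂ))
    fun i => ((x i).asHomogeneousIdeal.toIdeal.restrictScalars ℂ).comap Λ
  have hW : ⋃ o, (W o : Set (Fin (r + 1) → ℂ)) ≠ Set.univ := by
    intro h
    obtain ⟨o, ho⟩ := Subspace.exists_eq_top_of_iUnion_eq_univ h
    cases o with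
    | none =>
      have : Pi.single 0 1 ∈ W none := ho ▸ Submodule.mem_top
      simp [W] at this
    | some i =>
      obtain ⟨l, hl⟩ := (x i).exists_X_notMem
      have : Pi.single l 1 ∈ W (some i) := ho ▸ Submodule.mem_top
      refine hl ?_
      simpa [W, Λ] using this
  obtain ⟨a, ha⟩ := (Set.ne_univ_iff_exists_notMem _).mp hW
  rw [Set.mem_iUnion, not_exists] at ha
  exact ⟨a, ha none, fun i => ha (some i)⟩

variable (a : Fin (r + 1) → ℂ)

/-- The linear form with coefficients `a`. -/
def linearForm : MvPolynomial (Fin (r + 1)) ℂ := ∑ l, a l • MvPolynomial.X l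

theorem linearForm_mem :
    linearForm a ∈ MvPolynomial.homogeneousSubmodule (Fin (r + 1)) ℂ 1 :=
  Submodule.sum_mem _ fun l _ =>
    Submodule.smul_mem _ _ (MvPolynomial.X_mem_homogeneousSubmodule l)

/-- Restriction of polynomials to the affine hyperplane on which the linear form is `1`. -/
def dehomogenize : MvPolynomial (Fin (r + 1)) ℂ →ₐ[ℂ] MvPolynomial (Fin r) ℂ :=
  MvPolynomial.aeval (Fin.cons
    ((a 0)⁻¹ • (1 - ∑ l : Fin r, a l.succ • (MvPolynomial.X l : MvPolynomial (Fin r) ℂ)))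
    MvPolynomial.X)

variable {a} (ha : a 0 ≠ 0)

theorem dehomogenize_linearForm (ha : a 0 ≠ 0) : dehomogenize a (linearForm a) = 1 := by
  rw [linearForm, map_sum, Fin.sum_univ_succ]
  simp [dehomogenize, smul_smul, ha]

theorem isUnit_dehomogenize_linearForm (ha : a 0 ≠ 0) :
    IsUnit ((dehomogenize a : MvPolynomial (Fin (r + 1)) ℂ →+* MvPolynomial (Fin r) ℂ)
      (linearForm a)) :=
  (dehomogenize_linearForm ha).symm ▸ isUnit_one

/-- The ring homomorphism from the degree zero part of the localization at a linear form. -/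
def awayLinearFormHom : HomogeneousLocalization.Away
    (MvPolynomial.homogeneousSubmodule (Fin (r + 1)) ℂ) (linearForm a) →+*
      MvPolynomial (Fin r) ℂ :=
  (IsLocalization.Away.lift (S := Localization.Away (linearForm a)) (linearForm a)
    (isUnit_dehomogenize_linearForm ha)).comp (algebraMap _ (Localization.Away (linearForm a)))

theorem awayLinearFormHom_mk (n : ℕ) (F : MvPolynomial (Fin (r + 1)) ℂ)
    (hF : F ∈ MvPolynomial.homogeneousSubmodule (Fin (r + 1)) ℂ (n • 1)) :
    awayLinearFormHom ha (HomogeneousLocalization.Away.mk _ (linearForm_mem a) n F hF) =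
      dehomogenize a F := by
  change IsLocalization.Away.lift (S := Localization.Away (linearForm a)) (linearForm a)
    (isUnit_dehomogenize_linearForm ha)
    (HomogeneousLocalization.Away.mk _ (linearForm_mem a) n F hF).val = _
  rw [HomogeneousLocalization.Away.val_mk, Localization.mk_eq_mk', IsLocalization.Away.lift,
    IsLocalization.lift_mk'_spec]
  change dehomogenize a F = dehomogenize a (linearForm a ^ n) * dehomogenize a F
  rw [map_pow, dehomogenize_linearForm ha, one_pow, one_mul]

theorem awayLinearFormHom_fromZeroRingHom (c : ℂ) :
    awayLinearFormHom ha (HomogeneousLocalization.fromZeroRingHom _ _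
      (algebraMap ℂ (MvPolynomial.homogeneousSubmodule (Fin (r + 1)) ℂ 0) c)) =
      MvPolynomial.C c := by
  have h : HomogeneousLocalization.fromZeroRingHom _ _
      (algebraMap ℂ (MvPolynomial.homogeneousSubmodule (Fin (r + 1)) ℂ 0) c) =
      HomogeneousLocalization.Away.mk _ (linearForm_mem a) 0 (MvPolynomial.C c)
        (by simp) := by
    apply HomogeneousLocalization.val_injective
    rw [HomogeneousLocalization.Away.val_mk]
    simp only [pow_zero]
    rfl
  rw [h, awayLinearFormHom_mk]
  exact MvPolynomial.aeval_C _ c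

/-- Sending `X l` to `X l.succ` divided by the linear form inverts the map: for F of degree n,
homogeneity supplies exactly the denominator of degree n. -/
theorem awayLinearFormHom_bijective : Function.Bijective (awayLinearFormHom ha) := by
  let L := Localization.Away (linearForm a)
  let u : L := IsLocalization.Away.invSelf (linearForm a)
  have hu : algebraMap _ L (linearForm a) * u = 1 := IsLocalization.Away.mul_invSelf _
  let ξ : Fin (r + 1) → L := fun k =>
    algebraMap _ L (MvPolynomial.X k : MvPolynomial (Fin (r + 1)) ℂ)
  let θ : MvPolynomial (Fin r) ℂ →ₐ[ℂ] L :=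
    MvPolynomial.aeval fun l => u * ξ l.succ
  constructor
  · have hθ : ∀ k : Fin (r + 1), θ (dehomogenize a (MvPolynomial.X k)) = u * ξ k := by
      intro k
      cases k using Fin.cases with
      | zero =>
        have hsum : algebraMap _ L (linearForm a) = algebraMap ℂ L (a 0) * ξ 0 +
            ∑ l : Fin r, algebraMap ℂ L (a l.succ) * ξ l.succ := by
          simp [ξ, linearForm, Fin.sum_univ_succ, Algebra.smul_def,
            IsScalarTower.algebraMap_apply ℂ (MvPolynomial (Fin (r + 1)) ℂ) L]
        have h0 : algebraMap ℂ L (a 0)⁻¹ * algebraMap ℂ L (a 0) = 1 := by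
          rw [← map_mul, inv_mul_cancel₀ ha, map_one]
        simp only [dehomogenize, MvPolynomial.aeval_X, Fin.cons_zero, θ, Algebra.smul_def,
          map_mul, map_sub, map_one, map_sum, AlgHom.commutes]
        have hs : ∑ l : Fin r, algebraMap ℂ L (a l.succ) * (u * ξ l.succ) =
            u * ∑ l : Fin r, algebraMap ℂ L (a l.succ) * ξ l.succ := by
          rw [Finset.mul_sum]
          exact Finset.sum_congr rfl fun l _ => by ring
        rw [hs]
        rw [hsum] at hu
        linear_combination (-algebraMap ℂ L (a 0)⁻¹) * hu + u * ξ 0 * h0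
      | succ l => simp [dehomogenize, θ, ξ]
    have key : ∀ z, θ (awayLinearFormHom ha z) = z.val := by
      intro z
      obtain ⟨n, F, hF, rfl⟩ := HomogeneousLocalization.Away.mk_surjective _ (linearForm_mem a) z
      rw [awayLinearFormHom_mk, HomogeneousLocalization.Away.val_mk]
      have hcomp : (θ.comp (dehomogenize a)) F = MvPolynomial.aeval (fun k => u * ξ k) F :=
        DFunLike.congr_fun (MvPolynomial.algHom_ext fun k => by simpa using hθ k) F
      have hF' : F.IsHomogeneous n := by simpa using hF
      change (θ.comp (dehomogenize a)) F = _
      have hid : MvPolynomial.aeval ξ F = algebraMap _ L F :=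
        DFunLike.congr_fun (MvPolynomial.algHom_ext
          (f := MvPolynomial.aeval ξ) (g := IsScalarTower.toAlgHom ℂ _ L) fun k => by simp [ξ]) F
      rw [hcomp, hF'.aeval_mul, hid, Localization.mk_eq_mk', eq_comm,
        IsLocalization.mk'_eq_iff_eq_mul]
      simp only [map_pow]
      calc algebraMap _ L F = (algebraMap _ L (linearForm a) * u) ^ n * algebraMap _ L F := by
            rw [hu, one_pow, one_mul]
        _ = _ := by ring
    intro z w hzw
    apply HomogeneousLocalization.val_injective
    rw [← key z, ← key w, hzw]
  · intro p
    change p ∈ (awayLinearFormHom ha).range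
    induction p using MvPolynomial.induction_on with
    | C c => exact ⟨_, awayLinearFormHom_fromZeroRingHom ha c⟩
    | add p q hp hq => exact add_mem hp hq
    | mul_X p i hp =>
      refine mul_mem hp ⟨HomogeneousLocalization.Away.mk _ (linearForm_mem a) 1
        (MvPolynomial.X i.succ) (MvPolynomial.X_mem_homogeneousSubmodule _), ?_⟩
      rw [awayLinearFormHom_mk]
      simp [dehomogenize]

end HomogeneousCoordinates

section Chart

variable {r : ℕ} {a : Fin (r + 1) → ℂ} (ha : a 0 ≠ 0)

/-- The affine chart of projective space on the complement of the hyperplane with equation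
`linearForm a`. -/
def projectiveChart :
    Spec (.of (MvPolynomial (Fin r) ℂ)) ⟶ ComplexProjectiveSpace r :=
  Spec.map (CommRingCat.ofHom (awayLinearFormHom ha)) ≫
    Proj.awayι (MvPolynomial.homogeneousSubmodule (Fin (r + 1)) ℂ) (linearForm a)
      (linearForm_mem a) one_pos

theorem isIso_Spec_map_awayLinearFormHom :
    IsIso (Spec.map (CommRingCat.ofHom (awayLinearFormHom ha))) := by
  have : IsIso (CommRingCat.ofHom (awayLinearFormHom ha)) :=
    (RingEquiv.ofBijective _ (awayLinearFormHom_bijective ha)).toCommRingCatIso.isIso_hom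
  infer_instance

theorem isOpenImmersion_projectiveChart : IsOpenImmersion (projectiveChart ha) := by
  have := isIso_Spec_map_awayLinearFormHom ha
  have h : IsOpenImmersion (Proj.awayι (MvPolynomial.homogeneousSubmodule (Fin (r + 1)) ℂ)
      (linearForm a) (linearForm_mem a) one_pos) := inferInstance
  exact MorphismProperty.comp_mem @IsOpenImmersion _ _ inferInstance h

theorem projectiveChart_structureMap :
    projectiveChart ha ≫ ComplexProjectiveSpace.structureMap r =
      Spec.map (CommRingCat.ofHom (algebraMap ℂ (MvPolynomial (Fin r) ℂ))) := by
  have h : projectiveChart ha ≫ ComplexProjectiveSpace.structureMap r =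
      Spec.map (CommRingCat.ofHom (awayLinearFormHom ha)) ≫
        Spec.map (CommRingCat.ofHom (HomogeneousLocalization.fromZeroRingHom _ _)) ≫
          Spec.map (CommRingCat.ofHom
            (algebraMap ℂ (MvPolynomial.homogeneousSubmodule (Fin (r + 1)) ℂ 0))) :=
    (Category.assoc _ _ _).trans (congrArg (_ ≫ ·) (Proj.awayι_toSpecZero_assoc _ _ _ _ _))
  rw [h, ← Spec.map_comp, ← Spec.map_comp, ← CommRingCat.ofHom_comp, ← CommRingCat.ofHom_comp]
  congr 2
  ext1 c
  exact awayLinearFormHom_fromZeroRingHom ha c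

theorem exists_projectiveChart_eq
    (x : ProjectiveSpectrum (MvPolynomial.homogeneousSubmodule (Fin (r + 1)) ℂ))
    (hx : linearForm a ∉ x.asHomogeneousIdeal) :
    ∃ y : PrimeSpectrum (MvPolynomial (Fin r) ℂ), projectiveChart ha y = x := by
  have := isIso_Spec_map_awayLinearFormHom ha
  have hx' : x ∈ (Proj.awayι (MvPolynomial.homogeneousSubmodule (Fin (r + 1)) ℂ) (linearForm a)
      (linearForm_mem a) one_pos).opensRange := by
    rw [Proj.opensRange_awayι]
    exact hx
  obtain ⟨z, rfl⟩ := hx'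
  obtain ⟨y, rfl⟩ :=
    (Spec.map (CommRingCat.ofHom (awayLinearFormHom ha))).homeomorph.surjective z
  exact ⟨y, rfl⟩

end Chart

/-! ### Dimension of the components and the final assembly -/

theorem WithBot.exists_nat_eq_of_add_two_le {d : WithBot ℕ∞} (hd : 0 ≤ d) {r : ℕ}
    (h : d + 2 ≤ (r : WithBot ℕ∞)) : ∃ n : ℕ, d = n ∧ n + 2 ≤ r := by
  induction d with
  | bot => simp at hd
  | coe e =>
    have h' : e + 2 ≤ (r : ℕ∞) := WithBot.coe_le_coe.mp h
    induction e using ENat.recTopCoe with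
    | top => simp at h'
    | coe n => exact ⟨n, rfl, by exact_mod_cast h'⟩

/-- If `closure {ι y}` is the image of `T` under an embedding, where `ι` is inducing, then the
quotient by the prime `y` has dimension at most that of `T`. -/
theorem ringKrullDim_quotient_le_topologicalKrullDim {A : Type*} [CommRing A]
    {X Z : Type*} [TopologicalSpace X] [TopologicalSpace Z] {ι : PrimeSpectrum A → X}
    (hι : Topology.IsInducing ι) {j : Z → X} (hj : Topology.IsEmbedding j) {T : Set Z}
    {y : PrimeSpectrum A} (hy : closure {ι y} = j '' T) :
    ringKrullDim (A ⧸ y.asIdeal) ≤ topologicalKrullDim T := by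
  rw [← PrimeSpectrum.topologicalKrullDim_eq_ringKrullDim]
  have hg : Topology.IsInducing
      (ι ∘ PrimeSpectrum.comap (Ideal.Quotient.mk y.asIdeal)) :=
    hι.comp (PrimeSpectrum.isClosedEmbedding_comap_of_surjective _ _
      Ideal.Quotient.mk_surjective).isInducing
  have hmem : ∀ z, (ι ∘ PrimeSpectrum.comap (Ideal.Quotient.mk y.asIdeal)) z ∈ j '' T := by
    intro z
    rw [← hy, ← specializes_iff_mem_closure]
    refine Specializes.map ?_ hι.continuous
    rw [← PrimeSpectrum.le_iff_specializes]
    intro p hp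
    change Ideal.Quotient.mk _ p ∈ z.asIdeal
    rw [Ideal.Quotient.eq_zero_iff_mem.mpr hp]
    exact zero_mem _
  choose h hT hh using hmem
  have hind : Topology.IsInducing (fun z => (⟨h z, hT z⟩ : T)) := by
    have hjT : Topology.IsInducing (fun t : T => j t) := hj.isInducing.comp .subtypeVal
    rw [← hjT.of_comp_iff]
    convert hg using 1
    exact funext hh
  exact hind.topologicalKrullDim_le

theorem mainTheorem3 (r s : ℕ) (Z : Scheme.{0}) [AlgebraicGeometry.IsReduced Z]
    (j : Z ⟶ ComplexProjectiveSpace r) [IsClosedImmersion j]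
    (T : Fin s ≃ irreducibleComponents Z)
    (hrat : ∀ i, Scheme.IsRationalOver
      (reducedSubschemeι (componentClosed (T i)) ≫ j ≫ ComplexProjectiveSpace.structureMap r))
    (hdim : ∀ i, topologicalKrullDim (T i : Set Z) + 2 ≤ (r : WithBot ℕ∞)) :
    ∃ ω : ComplexProjectiveSpace r ⤏ ComplexProjectiveSpace r,
      IsBirationalMapOver (ComplexProjectiveSpace.structureMap r)
        (ComplexProjectiveSpace.structureMap r) ω ∧
      ∃ q : Fin s → ComplexProjectiveSpace r,
        Function.Injective q ∧ ∀ i, ContractsTo ω (j '' (T i : Set Z)) (q i) := by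
  obtain rfl | hs := eq_or_ne s 0
  · exact ⟨_, ⟨Scheme.PartialIso.refl _, by
      rw [Scheme.PartialIso.IsOver]
      exact Category.id_comp _, rfl⟩,
      Fin.elim0, fun i => i.elim0, fun i => i.elim0⟩
  have : NeZero s := ⟨hs⟩
  have hclosed : ∀ i, IsClosed (j '' (T i : Set Z)) := fun i =>
    j.isClosedEmbedding.isClosedMap _ (isClosed_of_mem_irreducibleComponents _ (T i).2)
  have hirr : ∀ i, IsIrreducible (j '' (T i : Set Z)) := fun i =>
    (T i).2.1.image j j.continuous.continuousOn
  let x : Fin s → ComplexProjectiveSpace r := fun i => (hirr i).genericPoint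
  have hx : ∀ i, closure {x i} = j '' (T i : Set Z) := fun i =>
    (hirr i).closure_genericPoint (hclosed i)
  -- Contraction concerns only a dense open part of each component, so it suffices that the
  -- hyperplane misses the generic points.
  obtain ⟨a, ha, hax⟩ := exists_linearForm_notMem x
  choose y hy using fun i => exists_projectiveChart_eq ha (x i) (hax i)
  have := isOpenImmersion_projectiveChart ha
  have hind : Topology.IsInducing (projectiveChart ha) :=
    (projectiveChart ha).isOpenEmbedding.isInducing
  have hkrull : ∀ i, ringKrullDim (MvPolynomial (Fin r) ℂ ⧸ (y i).asIdeal) + 2 ≤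
      (r : WithBot ℕ∞) := fun i =>
    le_trans (add_le_add_left (ringKrullDim_quotient_le_topologicalKrullDim hind
      j.isClosedEmbedding.isEmbedding ((congrArg (fun p => closure {p}) (hy i)).trans (hx i))) 2)
      (hdim i)
  have htrdeg : ∀ i, Algebra.trdeg ℂ (MvPolynomial (Fin r) ℂ ⧸ (y i).asIdeal) + 1 < r := by
    intro i
    obtain ⟨n, hn, hnr⟩ := WithBot.exists_nat_eq_of_add_two_le ringKrullDim_nonneg_of_nontrivial
      (hkrull i)
    have hle := trdeg_le_of_ringKrullDim_le (k := ℂ) hn.le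
    calc _ ≤ ((n : Cardinal) + 1) := by gcongr
      _ < r := by exact_mod_cast hnr
  -- There is at least one component here, so the dimension bound excludes r = 0.
  obtain _ | m := r
  · exact absurd (htrdeg 0) (by simp)
  -- An inclusion of primes reverses to an inclusion of components, which by maximality is an
  -- equality.
  have hinc : ∀ i k, i ≠ k → ¬ (y i).asIdeal ≤ (y k).asIdeal := by
    intro i k hik hle
    have hspec : y i ⤳ y k := (PrimeSpectrum.le_iff_specializes _ _).mp hle
    have h' := hspec.map hind.continuous
    rw [hy, hy, specializes_iff_closure_subset, hx, hx,
      Set.image_subset_image_iff j.isClosedEmbedding.injective] at h'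
    exact hik (T.injective (Subtype.ext ((T k).2.eq_of_subset (T i).2.1 h').symm))
  obtain ⟨ω, hω, q, hq, hc⟩ := exists_birational_contracting_of_chart
    (ComplexProjectiveSpace.structureMap (m + 1)) (projectiveChart ha)
    (projectiveChart_structureMap ha) y htrdeg hinc
  refine ⟨ω, hω, q, hq, fun i => ?_⟩
  rw [← hx, ← hy]
  exact hc i
end
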